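/- Let $n$ be a natural number and let all matrices be complex. Write $\circ$ for the Schur (entrywise) product, $J$ for an all-ones matrix, and $C^{-}$ for the Schur (entrywise) inverse of a matrix $C$ with no zero entry. For $C\in M_n(\mathbb C)$ let $X_C(M)=CM$ and $\Delta_C(M)=C\circ M$ be the corresponding linear operators on $M_n(\mathbb C)$. A pair $(A,B)$ of $n\times n$ matrices is an invertible Jones pair if $X_A$ and $\Delta_B$ are invertible, $X_A\Delta_BX_A=\Delta_BX_A\Delta_B$, $X_A\Delta_{B^T}X_A=\Delta_{B^T}X_A\Delta_{B^T}$, all entries of $A$ are nonzero and $B$ is an invertible matrix. For $n\times n$ matrices $C,D$ with no zero entry, let $N_{C,D}$ be the space of $n\times n$ matrices $M$ that have $Ce_i\circ De_j$ as an eigenvector for all $i,j$, and for $M\in N_{C,D}$ let $\Theta_{C,D}(M)$ be the $n\times n$ matrix with $M(Ce_i\circ De_j)=\Theta_{C,D}(M)_{ij}\,(Ce_i\circ De_j)$. Put $N_C=N_{C,C^{-}}$ and $\Theta_C=\Theta_{C,C^{-}}$. A Bose-Mesner algebra is a linear space of square matrices that contains $I$ and $J$, is closed under matrix multiplication, on which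 multiplication is commutative, and which is closed under transpose and under the Schur product. **Theorem.** Let $(A,B)$ be an invertible Jones pair with $A$ symmetric. Then $N_A\subseteq N_{B^{-}}$, the space $N_{A,B}$ is closed under transpose, and for every $H\in N_{A,B}$ there is a unique matrix $K$ with $K^T\in N_{A,B^T}$ and $\Theta_{A,B}(H)=\Theta_{A,B^T}(K^T)^T$ (we say that $K$ is paired with $H$). Thus for $F\in N_A$ and $G,H\in N_{A,B}$ the $4n\times4n$ matrix \[ M(F,G,H)=\begin{pmatrix} \Theta_A(F)+H & \Theta_A(F)-H & \Theta_{A,B}(G) & \Theta_{A,B}(G)\\ \Theta_A(F)-H & \Theta_A(F)+H & \Theta_{A,B}(G) & \Theta_{A,B}(G)\\ \Theta_{A,B}(G^T)^T & \Theta_{A,B}(G^T)^T & \Theta_{B^{-}}(F)+K & \Theta_{B^{-}}(F)-K\\ \Theta_{A,B}(G^T)^T & \Theta_{A,B}(G^T)^T & \Theta_{B^{-}}(F)-K & \Theta_{B^{-}}(F)+K \end{pmatrix}, \] with $K$ paired with $H$, is well defined. The set \[ \mathfrak B=\{M(F,G,H): F\in N_A,\ G,H\in N_{A,B}\} \] is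 a linear space, it is a Bose-Mesner algebra, and $\dim\mathfrak B=3\dim N_A$. -/

import Mathlib

namespace JonesPair

variable {ι : Type*} [Fintype ι]

/-- The matrix `J` with all entries equal to one. -/
def allOnes (ι : Type*) : Matrix ι ι ℂ := Matrix.of fun _ _ => 1

/-- All entries are nonzero. -/
def SchurInvertible (C : Matrix ι ι ℂ) : Prop := ∀ i j, C i j ≠ 0

/-- The Schur inverse: the entrywise inverse. -/
noncomputable def schurInv (C : Matrix ι ι ℂ) : Matrix ι ι ℂ := Matrix.of fun i j => (C i j)⁻¹

/-- The operator `X_C : M ↦ C M`. -/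
noncomputable def opX (C : Matrix ι ι ℂ) : Module.End ℂ (Matrix ι ι ℂ) where
  toFun M := C * M
  map_add' M N := Matrix.mul_add C M N
  map_smul' c M := Matrix.mul_smul C c M

/-- The operator `Δ_C : M ↦ C ∘ M` (Schur product). -/
noncomputable def opDelta (C : Matrix ι ι ℂ) : Module.End ℂ (Matrix ι ι ℂ) where
  toFun M := Matrix.hadamard C M
  map_add' M N := Matrix.hadamard_add C M N
  map_smul' c M := Matrix.hadamard_smul C M c

/-- `(A, B)` is a Jones pair. The product of endomorphisms is composition. -/
structure IsJonesPair (A B : Matrix ι ι ℂ) : Prop where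
  isUnit_opX : IsUnit (opX A)
  isUnit_opDelta : IsUnit (opDelta B)
  braid : opX A * opDelta B * opX A = opDelta B * opX A * opDelta B
  braid_transpose :
    opX A * opDelta B.transpose * opX A =
      opDelta B.transpose * opX A * opDelta B.transpose

/-- An invertible Jones pair: moreover `A` is Schur invertible and `B` is invertible. -/
structure IsInvertibleJonesPair [DecidableEq ι] (A B : Matrix ι ι ℂ) : Prop extends IsJonesPair A B where
  schurInvertible_left : SchurInvertible A
  isUnit_right : IsUnit B

/-- The vector `A e_i ∘ B e_j`. -/
def colProd (A B : Matrix ι ι ℂ) (i j : ι) : ι → ℂ := fun k => A k i * B k j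

/-- `S` is a matrix of eigenvalues of `M`: `M (A e_i ∘ B e_j) = S_{ij} (A e_i ∘ B e_j)`. -/
def IsEigenMatrix (A B M S : Matrix ι ι ℂ) : Prop :=
  ∀ i j, M.mulVec (colProd A B i j) = S i j • colProd A B i j

/-- The Nomura algebra `N_{A,B}` (as a vector space): all `M` of which every `A e_i ∘ B e_j` is an
eigenvector. If `A` and `B` are Schur invertible, these vectors are nonzero. -/
def nomura (A B : Matrix ι ι ℂ) : Submodule ℂ (Matrix ι ι ℂ) where
  carrier := {M | ∃ S, IsEigenMatrix A B M S}
  add_mem' := by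
    rintro M N ⟨S, hS⟩ ⟨T, hT⟩
    exact ⟨S + T, fun i j => by rw [Matrix.add_mulVec, hS, hT, Matrix.add_apply, add_smul]⟩
  zero_mem' := ⟨0, fun i j => by simp⟩
  smul_mem' := by
    rintro c M ⟨S, hS⟩
    exact ⟨c • S, fun i j => by
      rw [Matrix.smul_mulVec, hS, Matrix.smul_apply, smul_assoc]⟩

open Classical in
/-- The map `Θ_{A,B}` on `N_{A,B}`, extended by zero to all matrices. For Schur invertible
`A` and `B` the matrix of eigenvalues is unique, see `theta_eq`. -/
noncomputable def theta (A B M : Matrix ι ι ℂ) : Matrix ι ι ℂ :=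
  if h : ∃ S, IsEigenMatrix A B M S then h.choose else 0

theorem theta_spec {A B M : Matrix ι ι ℂ} (h : M ∈ nomura A B) :
    IsEigenMatrix A B M (theta A B M) := by
  have h' : ∃ S, IsEigenMatrix A B M S := h
  rw [theta, dif_pos h']
  exact h'.choose_spec

theorem theta_eq {A B M S : Matrix ι ι ℂ} (hA : SchurInvertible A) (hB : SchurInvertible B)
    (h : IsEigenMatrix A B M S) : theta A B M = S := by
  have h1 : IsEigenMatrix A B M (theta A B M) := theta_spec ⟨S, h⟩
  ext i j
  have h2 := congrFun ((h1 i j).symm.trans (h i j)) i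
  exact mul_right_cancel₀ (mul_ne_zero (hA i i) (hB i j)) h2

/-- The Nomura algebra `N_A = N_{A, A⁻}`, where `A⁻` is the Schur inverse of `A`. -/
noncomputable def nomura₁ (A : Matrix ι ι ℂ) : Submodule ℂ (Matrix ι ι ℂ) := nomura A (schurInv A)

/-- The map `Θ_A = Θ_{A, A⁻}`. -/
noncomputable def theta₁ (A M : Matrix ι ι ℂ) : Matrix ι ι ℂ := theta A (schurInv A) M

/-- `K` is paired with `H`: `K ∈ (N_{A,Bᵀ})ᵀ` and `Θ_{A,B}(H) = Θ_{A,Bᵀ}(Kᵀ)ᵀ`. -/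
def IsPaired (A B H K : Matrix ι ι ℂ) : Prop :=
  K.transpose ∈ nomura A B.transpose ∧
    theta A B H = (theta A B.transpose K.transpose).transpose

/-- The `4n × 4n` matrix `M(F, G, H)`, where `K` stands for the matrix paired with `H`. -/
noncomputable def blockMatrix (A B F G H K : Matrix ι ι ℂ) :
    Matrix ((ι ⊕ ι) ⊕ (ι ⊕ ι)) ((ι ⊕ ι) ⊕ (ι ⊕ ι)) ℂ :=
  Matrix.fromBlocks
    (Matrix.fromBlocks
      (theta₁ A F + H) (theta₁ A F - H)
      (theta₁ A F - H) (theta₁ A F + H))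
    (Matrix.fromBlocks
      (theta A B G) (theta A B G)
      (theta A B G) (theta A B G))
    (Matrix.fromBlocks
      (theta A B G.transpose).transpose (theta A B G.transpose).transpose
      (theta A B G.transpose).transpose (theta A B G.transpose).transpose)
    (Matrix.fromBlocks
      (theta₁ (schurInv B) F + K) (theta₁ (schurInv B) F - K)
      (theta₁ (schurInv B) F - K) (theta₁ (schurInv B) F + K))

/-- The set of all `M(F, G, H)` with `F ∈ N_A` and `G, H ∈ N_{A,B}`. -/
def blockSet (A B : Matrix ι ι ℂ) : Set (Matrix ((ι ⊕ ι) ⊕ (ι ⊕ ι)) ((ι ⊕ ι) ⊕ (ι ⊕ ι)) ℂ) :=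
  {M | ∃ F ∈ nomura₁ A, ∃ G ∈ nomura A B, ∃ H ∈ nomura A B, ∃ K,
    IsPaired A B H K ∧ M = blockMatrix A B F G H K}

/-- A Bose-Mesner algebra: a space of matrices that contains `I` and `J`, is a commutative algebra
under the matrix product, and is closed under transpose and Schur product. -/
structure IsBoseMesner [DecidableEq ι] (S : Submodule ℂ (Matrix ι ι ℂ)) : Prop where
  one_mem : (1 : Matrix ι ι ℂ) ∈ S
  allOnes_mem : allOnes ι ∈ S
  mul_mem : ∀ M ∈ S, ∀ N ∈ S, M * N ∈ S
  mul_comm : ∀ M ∈ S, ∀ N ∈ S, M * N = N * M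
  transpose_mem : ∀ M ∈ S, M.transpose ∈ S
  hadamard_mem : ∀ M ∈ S, ∀ N ∈ S, Matrix.hadamard M N ∈ S

end JonesPair

namespace JonesPair

variable {ι : Type*}

/-! All arguments run through relations `Intertwines`. They compose, with the matrices M multiplied
and the eigenvalue matrices S Schur-multiplied, and `Intertwines.exchange` trades M for S. The braid
relation says that A ∈ N_{A,B} with Θ_{A,B}(A) = B, and forces A and B to be type II. For symmetric
A, exchange shows that Bᵀ and B carry the vectors A e_i ∘ A⁻ e_j to those of the pair ((B⁻)ᵀ, Bᵀ)
and back, both times with eigenvalues nA. Hence B Bᵀ ∈ N_A, and φ(X) = B⁻¹XB is an automorphism of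
the Bose-Mesner algebra N_A for both products and the transpose; it commutes with Θ_A and fixes A ∘
A (`hasTheta_conj`, `conj_hadamard_self`). Moreover Θ_{B⁻}(F) = φ(Θ_A(F)).

Next, N_{A,B} = A ∘ N_A, Θ_{A,B}(A ∘ F) = n⁻¹ Θ_A(F) B, and A ∘ X is paired with A ∘ φ(X). So
M(F,G,H) has blocks R ± A∘X, QB, BᵀQ, φ(R) ± A∘φ(X) with R, Q, X free in N_A, whence the dimension.
Products split into a part with blocks R, QB, BᵀQ, φ(R), closed because B Bᵀ ∈ N_A, and a part A∘X,
A∘φ(X), closed because N_{A,B} is an algebra and pairing is multiplicative. Schur products close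
because φ respects them and fixes A ∘ A, and because QB ranges over the image of Θ_{A,B}. -/

@[simp] theorem schurInv_apply (C : Matrix ι ι ℂ) (i j : ι) : schurInv C i j = (C i j)⁻¹ := rfl

@[simp] theorem schurInv_schurInv (C : Matrix ι ι ℂ) : schurInv (schurInv C) = C := by
  ext i j; simp

theorem schurInv_transpose (C : Matrix ι ι ℂ) :
    schurInv C.transpose = (schurInv C).transpose := rfl

theorem SchurInvertible.transpose {C : Matrix ι ι ℂ} (h : SchurInvertible C) :
    SchurInvertible C.transpose := fun i j => h j i

theorem SchurInvertible.schurInv {C : Matrix ι ι ℂ} (h : SchurInvertible C) :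
    SchurInvertible (schurInv C) := fun i j => inv_ne_zero (h i j)

theorem colProd_swap (P Q : Matrix ι ι ℂ) (i j : ι) : colProd P Q i j = colProd Q P j i := by
  ext k; simp [colProd, mul_comm]

theorem schurInvertible_of_isUnit_opDelta {B : Matrix ι ι ℂ} (h : IsUnit (opDelta B)) :
    SchurInvertible B := by
  obtain ⟨M, hM⟩ := ((Module.End.isUnit_iff _).1 h).surjective (allOnes ι)
  intro i j h0
  have := congrFun (congrFun hM i) j
  simp [opDelta, allOnes, h0] at this

/-! ### Intertwining relations and type II matrices. -/

variable [Fintype ι]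

/-- A type II matrix: `C` is Schur invertible and `C (C⁻)ᵀ = n I`. -/
structure IsTypeII [DecidableEq ι] (C : Matrix ι ι ℂ) : Prop where
  schurInvertible : SchurInvertible C
  mul_eq : C * (schurInv C).transpose = (Fintype.card ι : ℂ) • (1 : Matrix ι ι ℂ)

/-- `M` maps every vector `P e_i ∘ Q e_j` to `S_{ij} (P' e_i ∘ Q' e_j)`. -/
def Intertwines (P Q P' Q' M S : Matrix ι ι ℂ) : Prop :=
  ∀ i j, M.mulVec (colProd P Q i j) = S i j • colProd P' Q' i j

theorem intertwines_iff {P Q P' Q' M S : Matrix ι ι ℂ} :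
    Intertwines P Q P' Q' M S ↔
      ∀ i j k, ∑ r, M k r * (P r i * Q r j) = S i j * (P' k i * Q' k j) := by
  simp only [Intertwines, funext_iff]
  rfl

namespace Intertwines

variable {P Q P' Q' P'' Q'' M M' S S' : Matrix ι ι ℂ}

theorem swap (h : Intertwines P Q P' Q' M S) : Intertwines Q P Q' P' M S.transpose :=
  fun i j => by rw [colProd_swap Q P, h j i, colProd_swap P' Q', Matrix.transpose_apply]

theorem comp (h : Intertwines P Q P' Q' M S) (h' : Intertwines P' Q' P'' Q'' M' S') :
    Intertwines P Q P'' Q'' (M' * M) (Matrix.hadamard S' S) := fun i j => by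
  rw [← Matrix.mulVec_mulVec, h i j, Matrix.mulVec_smul, h' i j, smul_smul, Matrix.hadamard_apply,
    mul_comm]

theorem smul (c : ℂ) (h : Intertwines P Q P' Q' M S) :
    Intertwines P Q P' Q' (c • M) (c • S) := fun i j => by
  rw [Matrix.smul_mulVec, h i j, smul_smul, Matrix.smul_apply, smul_eq_mul]

theorem of_smul {c : ℂ} (hc : c ≠ 0) (h : Intertwines P Q P' Q' (c • M) (c • S)) :
    Intertwines P Q P' Q' M S := by
  simpa [smul_smul, hc] using h.smul c⁻¹

theorem inv [DecidableEq ι] (h : Intertwines P Q P' Q' M S) (hM : IsUnit M)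
    (hS : SchurInvertible S) : Intertwines P' Q' P Q M⁻¹ (schurInv S) := fun i j => by
  have hdet := (Matrix.isUnit_iff_isUnit_det M).1 hM
  have h1 := congrArg (fun v => (S i j)⁻¹ • M⁻¹.mulVec v) (h i j)
  simp only [Matrix.mulVec_mulVec, Matrix.nonsing_inv_mul _ hdet, Matrix.one_mulVec,
    Matrix.mulVec_smul, smul_smul, inv_mul_cancel₀ (hS i j), one_smul] at h1
  exact h1.symm

theorem eigen_unique (hP : SchurInvertible P') (hQ : SchurInvertible Q')
    (h : Intertwines P Q P' Q' M S) (h' : Intertwines P Q P' Q' M S') : S = S' := by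
  ext i j
  have h2 := congrFun ((h i j).symm.trans (h' i j)) i
  exact mul_right_cancel₀ (mul_ne_zero (hP i i) (hQ i j)) h2

/-- In coordinates the hypothesis is a three-index identity. Multiplying by inverse entries of a row
of P and summing over the column index leaves a single term, since distinct rows of P are orthogonal
to each other's inverses. -/
theorem exchange [DecidableEq ι] (hP : IsTypeII P) (hQ : SchurInvertible Q')
    (h : Intertwines P Q P' Q' M S) :
    Intertwines P'.transpose (schurInv P).transpose (schurInv Q').transpose Q.transpose
      S.transpose ((Fintype.card ι : ℂ) • M) := by
  rw [intertwines_iff] at h ⊢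
  intro i x k
  have hP' : ∀ r, ∑ j, P r j * (P x j)⁻¹ = if r = x then (Fintype.card ι : ℂ) else 0 := fun r => by
    have := congrFun (congrFun hP.mul_eq r) x
    simpa [Matrix.mul_apply, Matrix.one_apply] using this
  calc _ = ∑ j, (Q' i k)⁻¹ * ((S j k * (P' i j * Q' i k)) * (P x j)⁻¹) := by
        refine Finset.sum_congr rfl fun j _ => ?_
        have := hQ i k
        simp only [Matrix.transpose_apply, schurInv_apply]
        field_simp
    _ = ∑ j, ∑ r, (Q' i k)⁻¹ * (M i r * Q r k) * (P r j * (P x j)⁻¹) := by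
        refine Finset.sum_congr rfl fun j _ => ?_
        rw [← h j k i, Finset.sum_mul, Finset.mul_sum]
        exact Finset.sum_congr rfl fun r _ => by ring
    _ = ∑ r, (Q' i k)⁻¹ * (M i r * Q r k) * ∑ j, P r j * (P x j)⁻¹ := by
        rw [Finset.sum_comm]
        exact Finset.sum_congr rfl fun r _ => by rw [Finset.mul_sum]
    _ = _ := by
        simp only [hP', mul_ite, mul_zero, Finset.sum_ite_eq', Finset.mem_univ, if_true,
          Matrix.transpose_apply, schurInv_apply, Matrix.smul_apply, smul_eq_mul]
        ring

end Intertwines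

namespace IsTypeII

variable [DecidableEq ι] {C : Matrix ι ι ℂ}

theorem transpose [Nonempty ι] (h : IsTypeII C) : IsTypeII C.transpose where
  schurInvertible := h.schurInvertible.transpose
  mul_eq := by
    have hn : (Fintype.card ι : ℂ) ≠ 0 := by simp
    have h1 : C * ((Fintype.card ι : ℂ)⁻¹ • (schurInv C).transpose) = 1 := by
      rw [Matrix.mul_smul, h.mul_eq, smul_smul, inv_mul_cancel₀ hn, one_smul]
    have h2 := mul_eq_one_comm.1 h1
    have h3 : (schurInv C).transpose * C = (Fintype.card ι : ℂ) • (1 : Matrix ι ι ℂ) := by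
      rw [← h2, Matrix.smul_mul, smul_smul, mul_inv_cancel₀ hn, one_smul]
    have h4 := congrArg Matrix.transpose h3
    simpa [Matrix.transpose_mul, schurInv_transpose] using h4

theorem schurInv (h : IsTypeII C) : IsTypeII (schurInv C) where
  schurInvertible := h.schurInvertible.schurInv
  mul_eq := by
    have h4 := congrArg Matrix.transpose h.mul_eq
    simpa [Matrix.transpose_mul] using h4

end IsTypeII

/-! ### Invertible Jones pairs consist of type II matrices. -/

section Basic

variable {A B : Matrix ι ι ℂ}

theorem isUnit_of_isUnit_opX [DecidableEq ι] (h : IsUnit (opX A)) : IsUnit A := by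
  obtain ⟨M, hM⟩ := ((Module.End.isUnit_iff _).1 h).surjective 1
  exact IsUnit.of_mul_eq_one M hM

theorem intertwines_of_braid [DecidableEq ι]
    (h : opX A * opDelta B * opX A = opDelta B * opX A * opDelta B) :
    Intertwines A B A B A B := by
  rw [intertwines_iff]
  intro i j k
  -- A test matrix whose row i is all ones, and zero elsewhere, handles every column j at once.
  have := congrFun (congrFun (LinearMap.congr_fun h
    (Matrix.of fun s _ => if s = i then 1 else 0)) k) j
  simp only [opX, opDelta, Module.End.mul_apply, LinearMap.coe_mk, AddHom.coe_mk,
    Matrix.mul_apply, Matrix.hadamard_apply, Matrix.of_apply, mul_ite, mul_one, mul_zero,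
    Finset.sum_ite_eq', Finset.mem_univ, if_true] at this
  calc _ = ∑ r, A k r * (B r j * A r i) := Finset.sum_congr rfl fun r _ => by ring
    _ = _ := by rw [this]; ring

variable [DecidableEq ι]

theorem IsInvertibleJonesPair.transpose (h : IsInvertibleJonesPair A B) :
    IsInvertibleJonesPair A B.transpose where
  isUnit_opX := h.isUnit_opX
  isUnit_opDelta := by
    have hB := schurInvertible_of_isUnit_opDelta h.isUnit_opDelta
    rw [Module.End.isUnit_iff]
    refine ⟨fun M N hMN => ?_, fun M => ⟨Matrix.hadamard (schurInv B.transpose) M, ?_⟩⟩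
    · ext i j
      exact mul_left_cancel₀ (hB j i) (congrFun (congrFun hMN i) j)
    · ext i j
      have := hB j i
      simp [opDelta, this]
  braid := h.braid_transpose
  braid_transpose := by simpa using h.braid
  schurInvertible_left := h.schurInvertible_left
  isUnit_right := by simpa [Matrix.isUnit_iff_isUnit_det] using h.isUnit_right

namespace IsInvertibleJonesPair

theorem schurInvertible_right (h : IsInvertibleJonesPair A B) : SchurInvertible B :=
  schurInvertible_of_isUnit_opDelta h.isUnit_opDelta

theorem isUnit_left (h : IsInvertibleJonesPair A B) : IsUnit A :=
  isUnit_of_isUnit_opX h.isUnit_opX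

theorem intertwines (h : IsInvertibleJonesPair A B) : Intertwines A B A B A B :=
  intertwines_of_braid h.braid

/-- Apply A⁻¹ to the eigenvector equation of A, divide by `B j k`, and contract k with B⁻¹. The type
II property of both matrices comes from specialising and summing this identity. -/
theorem sum_div_mul_inv (h : IsInvertibleJonesPair A B) (r j s : ι) :
    A r j * ∑ k, B r k * (B j k)⁻¹ * B⁻¹ k s = A⁻¹ r s * A s j := by
  have hA : A⁻¹ * A = 1 :=
    Matrix.nonsing_inv_mul _ ((Matrix.isUnit_iff_isUnit_det A).1 h.isUnit_left)
  have hB : B * B⁻¹ = 1 :=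
    Matrix.mul_nonsing_inv _ ((Matrix.isUnit_iff_isUnit_det B).1 h.isUnit_right)
  have h1 : ∀ k, A r j * B r k = ∑ i, A⁻¹ r i * (B j k * (A i j * B i k)) := fun k => by
    have h2 : ∀ i, B j k * (A i j * B i k) = A.mulVec (fun r => A r j * B r k) i := fun i =>
      ((intertwines_iff.1 h.intertwines) j k i).symm
    simp only [h2]
    change _ = A⁻¹.mulVec (A.mulVec _) r
    rw [Matrix.mulVec_mulVec, hA, Matrix.one_mulVec]
  have hBe : ∀ i, ∑ k, B i k * B⁻¹ k s = if i = s then 1 else 0 := fun i => by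
    simpa [Matrix.mul_apply, Matrix.one_apply] using congrFun (congrFun hB i) s
  calc _ = ∑ k, (A r j * B r k) * ((B j k)⁻¹ * B⁻¹ k s) := by
        rw [Finset.mul_sum]; exact Finset.sum_congr rfl fun k _ => by ring
    _ = ∑ k, ∑ i, A⁻¹ r i * A i j * (B i k * B⁻¹ k s) := by
        refine Finset.sum_congr rfl fun k _ => ?_
        rw [h1, Finset.sum_mul]
        refine Finset.sum_congr rfl fun i _ => ?_
        have := h.schurInvertible_right j k
        field_simp
    _ = ∑ i, A⁻¹ r i * A i j * ∑ k, B i k * B⁻¹ k s := by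
        rw [Finset.sum_comm]
        exact Finset.sum_congr rfl fun r _ => by rw [Finset.mul_sum]
    _ = _ := by simp [hBe]

theorem diag_mul_sum_inv (h : IsInvertibleJonesPair A B) (j s : ι) :
    A j j * ∑ k, B⁻¹ k s = A⁻¹ j s * A s j := by
  rw [← h.sum_div_mul_inv j j s]
  congr 1
  refine Finset.sum_congr rfl fun k _ => ?_
  rw [mul_inv_cancel₀ (h.schurInvertible_right j k), one_mul]

theorem trace_mul_sum_inv (h : IsInvertibleJonesPair A B) (s : ι) :
    A.trace * ∑ k, B⁻¹ k s = 1 := by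
  have hA : A * A⁻¹ = 1 :=
    Matrix.mul_nonsing_inv _ ((Matrix.isUnit_iff_isUnit_det A).1 h.isUnit_left)
  have := congrFun (congrFun hA s) s
  rw [Matrix.mul_apply, Matrix.one_apply_eq] at this
  rw [Matrix.trace, Finset.sum_mul, ← this]
  exact Finset.sum_congr rfl fun j _ => by
    rw [Matrix.diag_apply, h.diag_mul_sum_inv, mul_comm]

theorem sum_inv (h : IsInvertibleJonesPair A B) (s : ι) : ∑ k, B⁻¹ k s = A.trace⁻¹ :=
  eq_inv_of_mul_eq_one_right (h.trace_mul_sum_inv s)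

theorem card_mul_diag (h : IsInvertibleJonesPair A B) (j : ι) :
    (Fintype.card ι : ℂ) * (A j j * A.trace⁻¹) = 1 := by
  have hA : A⁻¹ * A = 1 :=
    Matrix.nonsing_inv_mul _ ((Matrix.isUnit_iff_isUnit_det A).1 h.isUnit_left)
  have := congrFun (congrFun hA j) j
  rw [Matrix.mul_apply, Matrix.one_apply_eq] at this
  rw [← this, ← nsmul_eq_mul, ← Finset.card_univ, ← Finset.sum_const]
  exact Finset.sum_congr rfl fun s _ => by rw [← h.diag_mul_sum_inv, h.sum_inv]

/-- Every `A⁻¹ j s * A s j` equals `A j j` divided by the trace, which is 1/n. -/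
theorem isTypeII_left (h : IsInvertibleJonesPair A B) : IsTypeII A where
  schurInvertible := h.schurInvertible_left
  mul_eq := by
    have hA : A * A⁻¹ = 1 :=
      Matrix.mul_nonsing_inv _ ((Matrix.isUnit_iff_isUnit_det A).1 h.isUnit_left)
    have h1 : (schurInv A).transpose = (Fintype.card ι : ℂ) • A⁻¹ := by
      ext j s
      have h2 := h.diag_mul_sum_inv j s
      have h3 := h.card_mul_diag j
      rw [h.sum_inv] at h2
      rw [h2] at h3
      simp only [Matrix.transpose_apply, schurInv_apply, Matrix.smul_apply, smul_eq_mul]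
      exact inv_eq_of_mul_eq_one_left (by rw [← h3]; ring)
    rw [h1, Matrix.mul_smul, hA]

/-- Sum `sum_div_mul_inv` over s. The row sums of B⁻¹ that appear are the column sums belonging to
the pair (A, Bᵀ), hence constant. -/
theorem isTypeII_right (h : IsInvertibleJonesPair A B) : IsTypeII B where
  schurInvertible := h.schurInvertible_right
  mul_eq := by
    have hA : A⁻¹ * A = 1 :=
      Matrix.nonsing_inv_mul _ ((Matrix.isUnit_iff_isUnit_det A).1 h.isUnit_left)
    ext r j
    have h1 : ∑ s, A r j * ∑ k, B r k * (B j k)⁻¹ * B⁻¹ k s = (1 : Matrix ι ι ℂ) r j := by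
      rw [← hA, Matrix.mul_apply]
      exact Finset.sum_congr rfl fun s _ => h.sum_div_mul_inv r j s
    have h2 : ∀ k, ∑ s, B⁻¹ k s = A.trace⁻¹ := fun k => by
      rw [← h.transpose.sum_inv k]
      exact Finset.sum_congr rfl fun s _ => by rw [← Matrix.transpose_nonsing_inv]; rfl
    rw [← Finset.mul_sum, Finset.sum_comm] at h1
    simp only [← Finset.mul_sum, h2, ← Finset.sum_mul] at h1
    simp only [Matrix.mul_apply, Matrix.transpose_apply, schurInv_apply, Matrix.smul_apply,
      smul_eq_mul]
    have h3 := h.card_mul_diag j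
    have h0 := h.schurInvertible_left r j
    by_cases hrj : r = j
    · subst hrj
      rw [Matrix.one_apply_eq] at h1 ⊢
      linear_combination (Fintype.card ι : ℂ) * h1 - (∑ k, B r k * (B r k)⁻¹) * h3
    · rw [Matrix.one_apply_ne hrj] at h1 ⊢
      have ht : A.trace⁻¹ ≠ 0 := fun h0 => by rw [h0] at h3; simp at h3
      simpa [h0, ht] using h1

end IsInvertibleJonesPair

end Basic

/-! ### Duality on N_A and conjugation by B. -/

/-- `F ∈ N_A` with `Θ_A(F) = S`. -/
abbrev HasTheta (A F S : Matrix ι ι ℂ) : Prop :=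
  Intertwines A (schurInv A) A (schurInv A) F S

theorem HasTheta.mem {A F S : Matrix ι ι ℂ} (h : HasTheta A F S) : F ∈ nomura₁ A := ⟨S, h⟩

theorem exists_hasTheta {A F : Matrix ι ι ℂ} (h : F ∈ nomura₁ A) : ∃ S, HasTheta A F S := h

theorem HasTheta.unique {A F S S' : Matrix ι ι ℂ} (hA : SchurInvertible A)
    (h : HasTheta A F S) (h' : HasTheta A F S') : S = S' :=
  h.eigen_unique hA hA.schurInv h'

theorem HasTheta.theta₁_eq {A F S : Matrix ι ι ℂ} (hA : SchurInvertible A)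
    (h : HasTheta A F S) : theta₁ A F = S :=
  theta_eq hA hA.schurInv h

theorem card_ne_zero [Nonempty ι] : (Fintype.card ι : ℂ) ≠ 0 := by simp

theorem HasTheta.mul {A F S F' S' : Matrix ι ι ℂ} (h : HasTheta A F S)
    (h' : HasTheta A F' S') :
    HasTheta A (F * F') (Matrix.hadamard S S') := h'.comp h

theorem mul_mem_nomura₁ {A X Y : Matrix ι ι ℂ} (hX : X ∈ nomura₁ A)
    (hY : Y ∈ nomura₁ A) : X * Y ∈ nomura₁ A := by
  obtain ⟨S, hS⟩ := exists_hasTheta hX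
  obtain ⟨T, hT⟩ := exists_hasTheta hY
  exact (hS.mul hT).mem

theorem intertwines_theta {A B G : Matrix ι ι ℂ} (hG : G ∈ nomura A B) :
    Intertwines A B A B G (theta A B G) := theta_spec hG

variable [DecidableEq ι]

theorem HasTheta.dual {A F S : Matrix ι ι ℂ} (hA : IsTypeII A) (h : HasTheta A F S) :
    HasTheta A.transpose S.transpose ((Fintype.card ι : ℂ) • F) := by
  have := h.exchange hA hA.schurInvertible.schurInv
  rwa [schurInv_schurInv] at this

theorem HasTheta.transpose [Nonempty ι] {A F S : Matrix ι ι ℂ} (hA : IsTypeII A)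
    (h : HasTheta A F S) : HasTheta A F.transpose S.transpose := by
  have := (h.dual hA).dual hA.transpose
  rw [Matrix.transpose_transpose, Matrix.transpose_smul] at this
  exact this.of_smul card_ne_zero

/-- Conjugation `X ↦ B⁻¹ X B`. -/
noncomputable def conj (B : Matrix ι ι ℂ) : Matrix ι ι ℂ →ₗ[ℂ] Matrix ι ι ℂ where
  toFun X := B⁻¹ * X * B
  map_add' X Y := by rw [Matrix.mul_add, Matrix.add_mul]
  map_smul' c X := by rw [Matrix.mul_smul, Matrix.smul_mul]; rfl

theorem conj_apply (B X : Matrix ι ι ℂ) : conj B X = B⁻¹ * X * B := rfl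

theorem mul_conj {B : Matrix ι ι ℂ} (hB : IsUnit B) (X : Matrix ι ι ℂ) :
    B * conj B X = X * B := by
  rw [conj_apply, Matrix.mul_assoc,
    Matrix.mul_nonsing_inv_cancel_left _ _ ((Matrix.isUnit_iff_isUnit_det B).1 hB)]

theorem conj_eq_iff {B : Matrix ι ι ℂ} (hB : IsUnit B) {X Y : Matrix ι ι ℂ} :
    conj B X = Y ↔ X * B = B * Y := by
  rw [← mul_conj hB, hB.mul_right_inj]

theorem conj_mul {B : Matrix ι ι ℂ} (hB : IsUnit B) (X Y : Matrix ι ι ℂ) :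
    conj B (X * Y) = conj B X * conj B Y := by
  rw [conj_eq_iff hB, ← Matrix.mul_assoc, mul_conj hB, Matrix.mul_assoc X Y B,
    Matrix.mul_assoc X B, mul_conj hB]

theorem conj_one {B : Matrix ι ι ℂ} (hB : IsUnit B) : conj B 1 = 1 := by
  rw [conj_eq_iff hB, Matrix.one_mul, Matrix.mul_one]

namespace IsInvertibleJonesPair

variable {A B F S F' S' : Matrix ι ι ℂ}

theorem intertwines_transpose_right (h : IsInvertibleJonesPair A B) (hA : A.IsSymm) :
    Intertwines A (schurInv A) (schurInv B).transpose B.transpose B.transpose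
      ((Fintype.card ι : ℂ) • A) := by
  have := h.intertwines.exchange h.isTypeII_left h.schurInvertible_right
  rwa [← schurInv_transpose, ← schurInv_transpose, hA.eq] at this

/-- Exchange in the second slot inverts the direction of `intertwines_transpose_right`. Both have
eigenvalues nA, which cancel under conjugation and give n² A∘A under composition. -/
theorem intertwines_right (h : IsInvertibleJonesPair A B) (hA : A.IsSymm) :
    Intertwines (schurInv B).transpose B.transpose A (schurInv A) B
      ((Fintype.card ι : ℂ) • A) := by
  have := (h.intertwines.swap.exchange h.isTypeII_right h.schurInvertible_left).swap
  rw [← schurInv_transpose, ← schurInv_transpose, Matrix.transpose_smul,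
    Matrix.transpose_transpose, hA.eq] at this
  exact this

theorem isUnit_transpose_right (h : IsInvertibleJonesPair A B) : IsUnit B.transpose :=
  h.transpose.isUnit_right

theorem schurInvertible_smul_left [Nonempty ι] (h : IsInvertibleJonesPair A B) :
    SchurInvertible ((Fintype.card ι : ℂ) • A) :=
  fun i j => mul_ne_zero card_ne_zero (h.schurInvertible_left i j)

theorem dual (h : IsInvertibleJonesPair A B) (hA : A.IsSymm) (hF : HasTheta A F S) :
    HasTheta A S.transpose ((Fintype.card ι : ℂ) • F) := by
  have := hF.dual h.isTypeII_left
  rwa [hA.eq] at this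

theorem dual' [Nonempty ι] (h : IsInvertibleJonesPair A B) (hA : A.IsSymm)
    (hF : HasTheta A F S) : HasTheta A S ((Fintype.card ι : ℂ) • F.transpose) := by
  have := (h.dual hA hF).transpose h.isTypeII_left
  rwa [Matrix.transpose_transpose, Matrix.transpose_smul] at this

/-- `Θ_A` is onto `N_A`. -/
theorem exists_theta_eq [Nonempty ι] (h : IsInvertibleJonesPair A B) (hA : A.IsSymm)
    (hS : S ∈ nomura₁ A) : ∃ F, HasTheta A F S := by
  obtain ⟨T, hT⟩ := exists_hasTheta hS
  have := (h.dual hA hT).smul (Fintype.card ι : ℂ)⁻¹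
  rw [smul_smul, inv_mul_cancel₀ card_ne_zero, one_smul] at this
  exact ⟨_, this⟩

theorem hasTheta_transpose_conj [Nonempty ι] (h : IsInvertibleJonesPair A B) (hA : A.IsSymm)
    (hF : HasTheta A F S) : HasTheta B.transpose (conj B F) S.transpose := by
  have h1 := h.intertwines_right hA
  have h2 := (h1.comp hF).comp (h1.inv h.isUnit_right h.schurInvertible_smul_left)
  rw [← Matrix.mul_assoc] at h2
  have h3 : Matrix.hadamard (schurInv ((Fintype.card ι : ℂ) • A))
      (Matrix.hadamard S ((Fintype.card ι : ℂ) • A)) = S := by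
    ext i j
    have := h.schurInvertible_smul_left i j
    simp only [Matrix.hadamard_apply, schurInv_apply]
    field_simp
  rw [h3] at h2
  exact h2.swap

theorem hasTheta_of_transpose_right [Nonempty ι] (h : IsInvertibleJonesPair A B)
    (hA : A.IsSymm) (hF : HasTheta B.transpose F S) :
    HasTheta A (B * F * B⁻¹) S.transpose := by
  have h1 := h.intertwines_right hA
  have h2 := ((h1.inv h.isUnit_right h.schurInvertible_smul_left).comp hF.swap).comp h1
  rw [← Matrix.mul_assoc] at h2
  have h3 : Matrix.hadamard ((Fintype.card ι : ℂ) • A)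
      (Matrix.hadamard S.transpose (schurInv ((Fintype.card ι : ℂ) • A))) = S.transpose := by
    ext i j
    have := h.schurInvertible_smul_left i j
    simp only [Matrix.hadamard_apply, schurInv_apply]
    field_simp
  rwa [h3] at h2

/-- By duality S lies in N_A, conjugation moves it to N_{Bᵀ}, and duality brings F back into N_B.
Passing from B to B⁻ only swaps the two columns, that is, transposes the eigenvalue matrix. -/
theorem hasTheta_schurInv_right [Nonempty ι] (h : IsInvertibleJonesPair A B) (hA : A.IsSymm)
    (hF : HasTheta A F S) : HasTheta (schurInv B) F (conj B S) := by
  have h1 := (h.hasTheta_transpose_conj hA (h.dual' hA hF)).dual h.isTypeII_right.transpose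
  rw [Matrix.transpose_transpose, Matrix.transpose_transpose] at h1
  have h2 := ((HasTheta.transpose h.isTypeII_right (h1.of_smul card_ne_zero))).swap
  rw [Matrix.transpose_transpose, Matrix.transpose_transpose] at h2
  rwa [HasTheta, schurInv_schurInv]

theorem hasTheta_of_right [Nonempty ι] (h : IsInvertibleJonesPair A B) (hA : A.IsSymm)
    (hF : HasTheta B F S) : HasTheta A F (B * S.transpose * B⁻¹) := by
  have h1 := h.dual hA (h.hasTheta_of_transpose_right hA (hF.dual h.isTypeII_right))
  rw [Matrix.transpose_transpose] at h1
  exact h1.of_smul card_ne_zero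

/-- `B Bᵀ ∈ N_A`. -/
theorem hasTheta_mul_transpose (h : IsInvertibleJonesPair A B) (hA : A.IsSymm) :
    HasTheta A (B * B.transpose)
      ((Fintype.card ι : ℂ) ^ 2 • Matrix.hadamard A A) := by
  have := (h.intertwines_transpose_right hA).comp (h.intertwines_right hA)
  rwa [Matrix.smul_hadamard, Matrix.hadamard_smul, smul_smul, ← pow_two] at this

end IsInvertibleJonesPair

section Algebra

variable {A B F S F' S' : Matrix ι ι ℂ}

theorem hasTheta_one : HasTheta A 1 (allOnes ι) := fun i j => by
  simp [allOnes]

theorem HasTheta.left_unique [Nonempty ι] (hA : IsTypeII A) (h : HasTheta A F S)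
    (h' : HasTheta A F' S) : F = F' := by
  have := HasTheta.unique hA.schurInvertible.transpose (h.dual hA) (h'.dual hA)
  exact smul_right_injective _ card_ne_zero this

end Algebra

/-! ### Conjugation by B as an automorphism of N_A. -/

namespace IsInvertibleJonesPair

variable {A B F S F' S' X Y : Matrix ι ι ℂ}

theorem mem_of_hasTheta [Nonempty ι] (h : IsInvertibleJonesPair A B) (hA : A.IsSymm)
    (hF : HasTheta A F S) : S ∈ nomura₁ A := (h.dual' hA hF).mem

theorem mul_comm_of_mem [Nonempty ι] (h : IsInvertibleJonesPair A B)
    (hX : X ∈ nomura₁ A) (hY : Y ∈ nomura₁ A) : X * Y = Y * X := by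
  obtain ⟨S, hS⟩ := exists_hasTheta hX
  obtain ⟨T, hT⟩ := exists_hasTheta hY
  refine HasTheta.left_unique h.isTypeII_left (hS.mul hT) ?_
  rw [Matrix.hadamard_comm]
  exact hT.mul hS

theorem transpose_mem [Nonempty ι] (h : IsInvertibleJonesPair A B)
    (hX : X ∈ nomura₁ A) : X.transpose ∈ nomura₁ A := by
  obtain ⟨S, hS⟩ := exists_hasTheta hX
  exact (hS.transpose h.isTypeII_left).mem

theorem hadamard_mem [Nonempty ι] (h : IsInvertibleJonesPair A B) (hA : A.IsSymm)
    (hX : X ∈ nomura₁ A) (hY : Y ∈ nomura₁ A) : Matrix.hadamard X Y ∈ nomura₁ A := by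
  obtain ⟨F, hF⟩ := h.exists_theta_eq hA hX
  obtain ⟨G, hG⟩ := h.exists_theta_eq hA hY
  exact h.mem_of_hasTheta hA (hF.mul hG)

theorem allOnes_mem [Nonempty ι] (h : IsInvertibleJonesPair A B) (hA : A.IsSymm) :
    allOnes ι ∈ nomura₁ A := h.mem_of_hasTheta hA hasTheta_one

theorem mul_transpose_mem (h : IsInvertibleJonesPair A B) (hA : A.IsSymm) :
    B * B.transpose ∈ nomura₁ A := (h.hasTheta_mul_transpose hA).mem

/-- X commutes with B Bᵀ, as both lie in N_A. This second form makes conjugation compatible with the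
transpose and with replacing B by Bᵀ. -/
theorem conj_eq [Nonempty ι] (h : IsInvertibleJonesPair A B) (hA : A.IsSymm)
    (hX : X ∈ nomura₁ A) : conj B X = B.transpose * X * B.transpose⁻¹ := by
  have h1 : B.transpose * B.transpose⁻¹ = 1 := Matrix.mul_nonsing_inv _
    ((Matrix.isUnit_iff_isUnit_det _).1 h.isUnit_transpose_right)
  rw [conj_eq_iff h.isUnit_right]
  calc X * B = X * (B * (B.transpose * B.transpose⁻¹)) := by rw [h1, Matrix.mul_one]
    _ = (X * (B * B.transpose)) * B.transpose⁻¹ := by simp only [Matrix.mul_assoc]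
    _ = _ := by
      rw [h.mul_comm_of_mem hX (h.mul_transpose_mem hA)]; simp only [Matrix.mul_assoc]

/-- Conjugation by `B` commutes with `Θ_A`. -/
theorem hasTheta_conj [Nonempty ι] (h : IsInvertibleJonesPair A B) (hA : A.IsSymm)
    (hF : HasTheta A F S) : HasTheta A (conj B F) (conj B S) := by
  have := h.transpose.hasTheta_of_right hA (h.hasTheta_transpose_conj hA hF)
  rwa [Matrix.transpose_transpose, ← h.conj_eq hA (h.mem_of_hasTheta hA hF)] at this

theorem conj_mem [Nonempty ι] (h : IsInvertibleJonesPair A B) (hA : A.IsSymm)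
    (hX : X ∈ nomura₁ A) : conj B X ∈ nomura₁ A := by
  obtain ⟨S, hS⟩ := exists_hasTheta hX
  exact (h.hasTheta_conj hA hS).mem

theorem conj_transpose [Nonempty ι] (h : IsInvertibleJonesPair A B) (hA : A.IsSymm)
    (hX : X ∈ nomura₁ A) : conj B X.transpose = (conj B X).transpose := by
  rw [h.conj_eq hA (h.transpose_mem hX), conj_apply, Matrix.transpose_mul, Matrix.transpose_mul,
    Matrix.transpose_nonsing_inv, Matrix.mul_assoc]

/-- Θ_A is onto N_A and turns products into Schur products; conjugation respects products and
commutes with Θ_A. -/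
theorem conj_hadamard [Nonempty ι] (h : IsInvertibleJonesPair A B) (hA : A.IsSymm)
    (hX : X ∈ nomura₁ A) (hY : Y ∈ nomura₁ A) :
    conj B (Matrix.hadamard X Y) = Matrix.hadamard (conj B X) (conj B Y) := by
  obtain ⟨F, hF⟩ := h.exists_theta_eq hA hX
  obtain ⟨G, hG⟩ := h.exists_theta_eq hA hY
  have h1 := h.hasTheta_conj hA (hF.mul hG)
  rw [conj_mul h.isUnit_right] at h1
  exact h1.unique h.schurInvertible_left ((h.hasTheta_conj hA hF).mul (h.hasTheta_conj hA hG))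

theorem hadamard_self_mem [Nonempty ι] (h : IsInvertibleJonesPair A B) (hA : A.IsSymm) :
    Matrix.hadamard A A ∈ nomura₁ A := by
  have := Submodule.smul_mem _ ((Fintype.card ι : ℂ) ^ 2)⁻¹
    (h.mem_of_hasTheta hA (h.hasTheta_mul_transpose hA))
  rwa [smul_smul, inv_mul_cancel₀ (pow_ne_zero _ card_ne_zero), one_smul] at this

/-- Conjugation takes B Bᵀ to BᵀB, and Θ_A sends both to n² A∘A, by the pairs (A, B) and (A, Bᵀ). -/
theorem conj_hadamard_self [Nonempty ι] (h : IsInvertibleJonesPair A B) (hA : A.IsSymm) :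
    conj B (Matrix.hadamard A A) = Matrix.hadamard A A := by
  have h1 := h.hasTheta_conj hA (h.hasTheta_mul_transpose hA)
  have h2 := h.transpose.hasTheta_mul_transpose hA
  have h3 : conj B (B * B.transpose) = B.transpose * B := by
    rw [conj_eq_iff h.isUnit_right, Matrix.mul_assoc]
  rw [Matrix.transpose_transpose] at h2
  rw [h3] at h1
  have h4 := HasTheta.unique h.schurInvertible_left h1 h2
  rw [map_smul] at h4
  exact smul_right_injective _ (pow_ne_zero 2 card_ne_zero) h4

end IsInvertibleJonesPair

end JonesPair

/-! ### The space N_{A,B} = A ∘ N_A and paired matrices. -/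

namespace JonesPair

variable {ι : Type*}

theorem hadamard_transpose {A : Matrix ι ι ℂ} (hA : A.IsSymm) (X : Matrix ι ι ℂ) :
    (Matrix.hadamard A X).transpose = Matrix.hadamard A X.transpose := by
  ext i j
  simp [hA.apply]

variable [Fintype ι] [DecidableEq ι]

/-- Exchange has order four up to the factor n², so three further exchanges undo one. -/
theorem Intertwines.of_exchange [Nonempty ι] {P Q P' Q' M S : Matrix ι ι ℂ}
    (hP : SchurInvertible P) (hP' : IsTypeII P') (hQ : IsTypeII Q) (hQ' : IsTypeII Q')
    (h : Intertwines P'.transpose (schurInv P).transpose (schurInv Q').transpose Q.transpose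
      S.transpose ((Fintype.card ι : ℂ) • M)) : Intertwines P Q P' Q' M S := by
  have h1 := h.exchange hP'.transpose hQ.schurInvertible.transpose
  have h2 := h1.exchange hQ'.schurInv hP.schurInv
  have h3 := h2.exchange hQ.schurInv.transpose hP'.schurInvertible.schurInv.transpose
  simp only [schurInv_transpose, Matrix.transpose_transpose, schurInv_schurInv,
    Matrix.transpose_smul] at h3
  exact (h3.of_smul card_ne_zero).of_smul card_ne_zero

namespace IsInvertibleJonesPair

variable {A B F S H K G X Y H' K' S' : Matrix ι ι ℂ}

/-- `Θ_{A,B}(A ∘ F) = n⁻¹ Θ_A(F) B`. -/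
theorem intertwines_hadamard [Nonempty ι] (h : IsInvertibleJonesPair A B) (hA : A.IsSymm)
    (hF : HasTheta A F S) :
    Intertwines A B A B (Matrix.hadamard A F) ((Fintype.card ι : ℂ)⁻¹ • (S * B)) := by
  refine Intertwines.of_exchange h.schurInvertible_left h.isTypeII_left h.isTypeII_right
    h.isTypeII_right (Intertwines.of_smul (card_ne_zero (ι := ι)) ?_)
  have := (h.dual hA hF).comp (h.intertwines_transpose_right hA)
  rw [Matrix.smul_hadamard, Matrix.hadamard_smul, ← Matrix.transpose_mul] at this
  rw [Matrix.transpose_smul, smul_smul _ (_⁻¹), mul_inv_cancel₀ card_ne_zero, one_smul,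
    ← schurInv_transpose, ← schurInv_transpose, hA.eq]
  exact this

theorem theta_hadamard [Nonempty ι] (h : IsInvertibleJonesPair A B) (hA : A.IsSymm)
    (hF : HasTheta A F S) :
    theta A B (Matrix.hadamard A F) = (Fintype.card ι : ℂ)⁻¹ • (S * B) :=
  theta_eq h.schurInvertible_left h.schurInvertible_right (h.intertwines_hadamard hA hF)

theorem hadamard_mem_nomura [Nonempty ι] (h : IsInvertibleJonesPair A B) (hA : A.IsSymm)
    (hF : F ∈ nomura₁ A) : Matrix.hadamard A F ∈ nomura A B := by
  obtain ⟨S, hS⟩ := exists_hasTheta hF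
  exact ⟨_, h.intertwines_hadamard hA hS⟩

/-- `N_{A,B} = A ∘ N_A`. -/
theorem exists_hadamard_eq [Nonempty ι] (h : IsInvertibleJonesPair A B) (hA : A.IsSymm)
    (hG : G ∈ nomura A B) : ∃ F ∈ nomura₁ A, Matrix.hadamard A F = G := by
  obtain ⟨S, hS⟩ : ∃ S, Intertwines A B A B G S := hG
  have h1 := hS.exchange h.isTypeII_left h.schurInvertible_right
  rw [← schurInv_transpose, ← schurInv_transpose, hA.eq] at h1
  -- Undoing Bᵀ after Sᵀ gives an element of N_A with eigenvalues nG/(nA), so A⁻ ∘ G is a value of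
  -- Θ_A.
  have h2 := (h.intertwines_transpose_right hA).inv h.isUnit_transpose_right
    h.schurInvertible_smul_left
  refine ⟨_, h.mem_of_hasTheta hA (h1.comp h2), ?_⟩
  ext i j
  have h3 := h.schurInvertible_left i j
  have h4 : (Fintype.card ι : ℂ) ≠ 0 := card_ne_zero
  simp only [Matrix.hadamard_apply, schurInv_apply, Matrix.smul_apply, smul_eq_mul]
  field_simp

theorem hadamard_injective (h : IsInvertibleJonesPair A B)
    (hXY : Matrix.hadamard A X = Matrix.hadamard A Y) : X = Y := by
  ext i j
  exact mul_left_cancel₀ (h.schurInvertible_left i j) (congrFun (congrFun hXY i) j)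

theorem theta_injective [Nonempty ι] (h : IsInvertibleJonesPair A B)
    (h1 : Intertwines A B A B G S) (h2 : Intertwines A B A B H S) : G = H := by
  have h3 := h1.exchange h.isTypeII_left h.schurInvertible_right
  have h4 := h2.exchange h.isTypeII_left h.schurInvertible_right
  have := h3.eigen_unique h.schurInvertible_right.schurInv.transpose
    h.schurInvertible_right.transpose h4
  exact smul_right_injective _ card_ne_zero this

theorem isPaired_iff (h : IsInvertibleJonesPair A B) (hH : H ∈ nomura A B) :
    IsPaired A B H K ↔ ∃ S, Intertwines A B A B H S ∧
      Intertwines A B.transpose A B.transpose K.transpose S.transpose := by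
  have hA := h.schurInvertible_left
  have hB := h.schurInvertible_right
  constructor
  · rintro ⟨h1, h2⟩
    refine ⟨_, theta_spec hH, ?_⟩
    rw [h2, Matrix.transpose_transpose]
    exact theta_spec h1
  · rintro ⟨S, h1, h2⟩
    refine ⟨⟨_, h2⟩, ?_⟩
    rw [theta_eq hA hB h1, theta_eq hA hB.transpose h2, Matrix.transpose_transpose]

/-- With φ conjugation by B, SB = Bφ(S) is the transpose of φ(S)ᵀBᵀ, and n⁻¹φ(S)ᵀBᵀ is the value of
Θ_{A,Bᵀ} at A ∘ φ(F)ᵀ. -/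
theorem isPaired_hadamard [Nonempty ι] (h : IsInvertibleJonesPair A B) (hA : A.IsSymm)
    (hF : F ∈ nomura₁ A) :
    IsPaired A B (Matrix.hadamard A F) (Matrix.hadamard A (conj B F)) := by
  obtain ⟨S, hS⟩ := exists_hasTheta hF
  rw [h.isPaired_iff (h.hadamard_mem_nomura hA hF)]
  refine ⟨_, h.intertwines_hadamard hA hS, ?_⟩
  have h1 := h.transpose.intertwines_hadamard hA
    ((h.hasTheta_conj hA hS).transpose h.isTypeII_left)
  rw [← Matrix.transpose_mul, mul_conj h.isUnit_right] at h1
  rw [Matrix.transpose_smul]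
  convert h1 using 1
  ext i j
  simp [hA.apply]

theorem isPaired_unique [Nonempty ι] (h : IsInvertibleJonesPair A B)
    (h1 : IsPaired A B H K) (h2 : IsPaired A B H K') : K = K' := by
  have h3 := theta_spec h1.1
  have h4 := theta_spec h2.1
  rw [Matrix.transpose_injective (h1.2.symm.trans h2.2)] at h3
  exact Matrix.transpose_injective (h.transpose.theta_injective h3 h4)

theorem transpose_mem_nomura [Nonempty ι] (h : IsInvertibleJonesPair A B) (hA : A.IsSymm)
    (hG : G ∈ nomura A B) : G.transpose ∈ nomura A B := by
  obtain ⟨F, hF, rfl⟩ := h.exists_hadamard_eq hA hG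
  rw [hadamard_transpose hA]
  exact h.hadamard_mem_nomura hA (h.transpose_mem hF)

theorem nomura_mul_comm [Nonempty ι] (h : IsInvertibleJonesPair A B)
    (hG : G ∈ nomura A B) (hH : H ∈ nomura A B) : G * H = H * G := by
  have h1 := (intertwines_theta hG).comp (intertwines_theta hH)
  have h2 := (intertwines_theta hH).comp (intertwines_theta hG)
  rw [Matrix.hadamard_comm] at h1
  exact h.theta_injective h2 h1

theorem hadamard_mul_comm [Nonempty ι] (h : IsInvertibleJonesPair A B) (hA : A.IsSymm)
    (hX : X ∈ nomura₁ A) (hY : Y ∈ nomura₁ A) :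
    Matrix.hadamard A X * Matrix.hadamard A Y = Matrix.hadamard A Y * Matrix.hadamard A X :=
  h.nomura_mul_comm (h.hadamard_mem_nomura hA hX) (h.hadamard_mem_nomura hA hY)

/-- The map `A ∘ X ↦ A ∘ B⁻¹ X B` on `A ∘ N_A` is multiplicative. -/
theorem exists_hadamard_mul [Nonempty ι] (h : IsInvertibleJonesPair A B) (hA : A.IsSymm)
    (hX : X ∈ nomura₁ A) (hY : Y ∈ nomura₁ A) :
    ∃ Z ∈ nomura₁ A, Matrix.hadamard A X * Matrix.hadamard A Y = Matrix.hadamard A Z ∧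
      Matrix.hadamard A (conj B X) * Matrix.hadamard A (conj B Y) =
        Matrix.hadamard A (conj B Z) := by
  obtain ⟨S, hS, hS'⟩ := (h.isPaired_iff (h.hadamard_mem_nomura hA hX)).1
    (h.isPaired_hadamard hA hX)
  obtain ⟨T, hT, hT'⟩ := (h.isPaired_iff (h.hadamard_mem_nomura hA hY)).1
    (h.isPaired_hadamard hA hY)
  have h1 := hT.comp hS
  obtain ⟨Z, hZ, hZ'⟩ := h.exists_hadamard_eq hA ⟨_, h1⟩
  refine ⟨Z, hZ, hZ'.symm, ?_⟩
  rw [← hZ'] at h1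
  have h2 := hS'.comp hT'
  rw [← Matrix.transpose_mul, Matrix.hadamard_comm T.transpose] at h2
  exact h.isPaired_unique ((h.isPaired_iff (h.hadamard_mem_nomura hA hZ)).2 ⟨_, h1, h2⟩)
    (h.isPaired_hadamard hA hZ)

theorem exists_hadamard_eq_one [Nonempty ι] (h : IsInvertibleJonesPair A B) (hA : A.IsSymm) :
    ∃ Z ∈ nomura₁ A, Matrix.hadamard A Z = 1 ∧ Matrix.hadamard A (conj B Z) = 1 := by
  have h1 : ∀ C : Matrix ι ι ℂ, Intertwines A C A C 1 (allOnes ι) := fun C i j => by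
    simp [allOnes]
  obtain ⟨Z, hZ, hZ'⟩ := h.exists_hadamard_eq hA ⟨_, h1 B⟩
  refine ⟨Z, hZ, hZ', h.isPaired_unique (h.isPaired_hadamard hA hZ) ?_⟩
  rw [hZ']
  refine (h.isPaired_iff ⟨_, h1 B⟩).2 ⟨_, h1 B, ?_⟩
  rw [Matrix.transpose_one]
  exact h1 _

theorem theta_hadamard_transpose [Nonempty ι] (h : IsInvertibleJonesPair A B) (hA : A.IsSymm)
    (hF : HasTheta A F S) :
    theta A B (Matrix.hadamard A F).transpose =
      (Fintype.card ι : ℂ)⁻¹ • (S.transpose * B) := by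
  rw [hadamard_transpose hA]
  exact h.theta_hadamard hA (hF.transpose h.isTypeII_left)

theorem theta_mul (h : IsInvertibleJonesPair A B)
    (hG : G ∈ nomura A B) (hH : H ∈ nomura A B) :
    theta A B (G * H) = Matrix.hadamard (theta A B G) (theta A B H) :=
  theta_eq h.schurInvertible_left h.schurInvertible_right
    ((intertwines_theta hH).comp (intertwines_theta hG))

/-- `N_A B` and `Bᵀ N_A` are compatibly closed under the Schur product. -/
theorem exists_mul_hadamard [Nonempty ι] (h : IsInvertibleJonesPair A B) (hA : A.IsSymm)
    (hX : X ∈ nomura₁ A) (hY : Y ∈ nomura₁ A) :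
    ∃ Z ∈ nomura₁ A, Matrix.hadamard (X * B) (Y * B) = Z * B ∧
      Matrix.hadamard (B.transpose * X) (B.transpose * Y) = B.transpose * Z := by
  obtain ⟨F, hF⟩ := h.exists_theta_eq hA hX
  obtain ⟨G, hG⟩ := h.exists_theta_eq hA hY
  have hFm := h.hadamard_mem_nomura hA hF.mem
  have hGm := h.hadamard_mem_nomura hA hG.mem
  obtain ⟨E, hE, hE', -⟩ := h.exists_hadamard_mul hA hF.mem hG.mem
  obtain ⟨Z, hZ⟩ := exists_hasTheta hE
  have hn : (Fintype.card ι : ℂ) ≠ 0 := card_ne_zero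
  have h1 := h.theta_mul hFm hGm
  have h2 := h.theta_mul (h.transpose_mem_nomura hA hFm) (h.transpose_mem_nomura hA hGm)
  -- Commuting the transposes makes their product the transpose of A ∘ E, so one E serves both
  -- identities.
  rw [h.nomura_mul_comm (h.transpose_mem_nomura hA hFm) (h.transpose_mem_nomura hA hGm),
    ← Matrix.transpose_mul] at h2
  rw [hE', h.theta_hadamard_transpose hA hF, h.theta_hadamard_transpose hA hG,
    h.theta_hadamard_transpose hA hZ] at h2
  rw [hE', h.theta_hadamard hA hF, h.theta_hadamard hA hG, h.theta_hadamard hA hZ] at h1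
  have h3 := congrArg Matrix.transpose h2
  simp only [Matrix.smul_hadamard, Matrix.hadamard_smul, Matrix.transpose_smul,
    Matrix.transpose_mul, Matrix.transpose_transpose, Matrix.transpose_hadamard] at h1 h3
  have h4 := smul_right_injective _ (inv_ne_zero hn) h1
  have h5 := smul_right_injective _ (inv_ne_zero hn) h3
  refine ⟨(Fintype.card ι : ℂ) • Z, Submodule.smul_mem _ _ (h.mem_of_hasTheta hA hZ), ?_, ?_⟩
  · rw [Matrix.smul_mul, h4, smul_smul, mul_inv_cancel₀ hn, one_smul]
  · rw [Matrix.mul_smul, h5, smul_smul, mul_inv_cancel₀ hn, one_smul]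

theorem exists_mul_eq_allOnes [Nonempty ι] (h : IsInvertibleJonesPair A B) (hA : A.IsSymm) :
    ∃ Z ∈ nomura₁ A, Z * B = allOnes ι ∧ B.transpose * Z = allOnes ι := by
  have h1 : Intertwines A B A B 1 (allOnes ι) := fun i j => by simp [allOnes]
  have h0 : theta A B 1 = allOnes ι :=
    theta_eq h.schurInvertible_left h.schurInvertible_right h1
  obtain ⟨F, hF, hF'⟩ := h.exists_hadamard_eq hA ⟨_, h1⟩
  obtain ⟨Z, hZ⟩ := exists_hasTheta hF
  have h2 := h.theta_hadamard hA hZ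
  have h3 := h.theta_hadamard_transpose hA hZ
  rw [hF', h0] at h2
  rw [hF', Matrix.transpose_one, h0] at h3
  refine ⟨(Fintype.card ι : ℂ)⁻¹ • Z, Submodule.smul_mem _ _ (h.mem_of_hasTheta hA hZ), ?_, ?_⟩
  · rw [h2, Matrix.smul_mul]
  · have h4 := congrArg Matrix.transpose h3
    rw [Matrix.transpose_smul, Matrix.transpose_mul, Matrix.transpose_transpose] at h4
    rw [Matrix.mul_smul, ← h4]
    rfl

end IsInvertibleJonesPair

end JonesPair

/-! ### The block matrices and their Bose-Mesner algebra. -/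

namespace JonesPair

variable {ι : Type*}

/-- The block shape of the matrices `M(F, G, H)`. -/
def doubledBlocks (R H X Y S K : Matrix ι ι ℂ) :
    Matrix ((ι ⊕ ι) ⊕ (ι ⊕ ι)) ((ι ⊕ ι) ⊕ (ι ⊕ ι)) ℂ :=
  Matrix.fromBlocks
    (Matrix.fromBlocks (R + H) (R - H) (R - H) (R + H)) (Matrix.fromBlocks X X X X)
    (Matrix.fromBlocks Y Y Y Y) (Matrix.fromBlocks (S + K) (S - K) (S - K) (S + K))

section DoubledBlocks

variable (R H X Y S K R' H' X' Y' S' K' : Matrix ι ι ℂ)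

/-- R, X, Y, S form the part constant on doubled indices, H and K the alternating part. The two
parts annihilate each other, and the doubling produces the factor 2. -/
theorem doubledBlocks_mul [Fintype ι] :
    doubledBlocks R H X Y S K * doubledBlocks R' H' X' Y' S' K' =
      doubledBlocks ((2 : ℂ) • (R * R' + X * Y')) ((2 : ℂ) • (H * H'))
        ((2 : ℂ) • (R * X' + X * S')) ((2 : ℂ) • (Y * R' + S * Y'))
        ((2 : ℂ) • (Y * X' + S * S')) ((2 : ℂ) • (K * K')) := by
  simp only [doubledBlocks, Matrix.fromBlocks_multiply, Matrix.fromBlocks_add, two_smul,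
    Matrix.fromBlocks_inj]
  refine ⟨⟨?_, ?_, ?_, ?_⟩, ⟨?_, ?_, ?_, ?_⟩, ⟨?_, ?_, ?_, ?_⟩, ⟨?_, ?_, ?_, ?_⟩⟩ <;>
    noncomm_ring

theorem doubledBlocks_hadamard :
    Matrix.hadamard (doubledBlocks R H X Y S K) (doubledBlocks R' H' X' Y' S' K') =
      doubledBlocks (Matrix.hadamard R R' + Matrix.hadamard H H')
        (Matrix.hadamard R H' + Matrix.hadamard H R')
        (Matrix.hadamard X X') (Matrix.hadamard Y Y')
        (Matrix.hadamard S S' + Matrix.hadamard K K')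
        (Matrix.hadamard S K' + Matrix.hadamard K S') := by
  ext i j
  rcases i with (i | i) | (i | i) <;> rcases j with (j | j) | (j | j) <;>
    simp [doubledBlocks] <;> ring

theorem doubledBlocks_transpose :
    (doubledBlocks R H X Y S K).transpose =
      doubledBlocks R.transpose H.transpose Y.transpose X.transpose S.transpose K.transpose := by
  simp [doubledBlocks, Matrix.fromBlocks_transpose]

theorem doubledBlocks_add :
    doubledBlocks R H X Y S K + doubledBlocks R' H' X' Y' S' K' =
      doubledBlocks (R + R') (H + H') (X + X') (Y + Y') (S + S') (K + K') := by
  simp only [doubledBlocks, Matrix.fromBlocks_add, Matrix.fromBlocks_inj]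
  refine ⟨⟨?_, ?_, ?_, ?_⟩, trivial, trivial, ⟨?_, ?_, ?_, ?_⟩⟩ <;> abel

theorem doubledBlocks_smul (c : ℂ) :
    c • doubledBlocks R H X Y S K =
      doubledBlocks (c • R) (c • H) (c • X) (c • Y) (c • S) (c • K) := by
  simp only [doubledBlocks, Matrix.fromBlocks_smul, smul_add, smul_sub]

variable {R H X Y S K R' H' X' Y' S' K'}

theorem doubledBlocks_inj
    (h : doubledBlocks R H X Y S K = doubledBlocks R' H' X' Y' S' K') :
    R = R' ∧ H = H' ∧ X = X' := by
  simp only [doubledBlocks, Matrix.fromBlocks_inj] at h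
  obtain ⟨⟨h1, h2, -, -⟩, ⟨h3, -, -, -⟩, -, -⟩ := h
  refine ⟨?_, ?_, h3⟩
  · refine smul_right_injective _ (two_ne_zero (α := ℂ)) ?_
    have := congrArg₂ (· + ·) h1 h2
    simp only [add_add_sub_cancel] at this
    simpa only [two_smul] using this
  · refine smul_right_injective _ (two_ne_zero (α := ℂ)) ?_
    have := congrArg₂ (· - ·) h1 h2
    simp only [add_sub_sub_cancel] at this
    simpa only [two_smul] using this

theorem doubledBlocks_one [DecidableEq ι] :
    doubledBlocks ((2 : ℂ)⁻¹ • (1 : Matrix ι ι ℂ)) ((2 : ℂ)⁻¹ • 1) 0 0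
      ((2 : ℂ)⁻¹ • 1) ((2 : ℂ)⁻¹ • 1) = 1 := by
  simp only [doubledBlocks, ← add_smul, sub_self, ← Matrix.fromBlocks_one, Matrix.fromBlocks_inj]
  norm_num

theorem doubledBlocks_allOnes :
    doubledBlocks (allOnes ι) 0 (allOnes ι) (allOnes ι) (allOnes ι) 0 =
      allOnes ((ι ⊕ ι) ⊕ (ι ⊕ ι)) := by
  ext i j
  rcases i with (i | i) | (i | i) <;> rcases j with (j | j) | (j | j) <;>
    simp [doubledBlocks, allOnes]

end DoubledBlocks

variable [Fintype ι] [DecidableEq ι]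

/-- The matrix `M(F, G, H)` in terms of `R = Θ_A(F)`, `Q = n⁻¹ Θ_A(A⁻ ∘ G)` and
`X = A⁻ ∘ H`. -/
noncomputable def blockMap (A B : Matrix ι ι ℂ) :
    Matrix ι ι ℂ × Matrix ι ι ℂ × Matrix ι ι ℂ →ₗ[ℂ]
      Matrix ((ι ⊕ ι) ⊕ (ι ⊕ ι)) ((ι ⊕ ι) ⊕ (ι ⊕ ι)) ℂ where
  toFun p := doubledBlocks p.1 (Matrix.hadamard A p.2.2) (p.2.1 * B) (B.transpose * p.2.1)
    (conj B p.1) (Matrix.hadamard A (conj B p.2.2))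
  map_add' p q := by
    simp only [doubledBlocks_add, Prod.fst_add, Prod.snd_add, map_add, Matrix.add_mul,
      Matrix.mul_add, Matrix.hadamard_add]
  map_smul' c p := by
    simp only [doubledBlocks_smul, Prod.smul_fst, Prod.smul_snd, map_smul, Matrix.smul_mul,
      Matrix.mul_smul, Matrix.hadamard_smul, RingHom.id_apply]

theorem blockMap_apply (A B R Q X : Matrix ι ι ℂ) :
    blockMap A B (R, Q, X) = doubledBlocks R (Matrix.hadamard A X) (Q * B) (B.transpose * Q)
      (conj B R) (Matrix.hadamard A (conj B X)) := rfl

/-- The space of the matrices `M(F, G, H)`. -/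
noncomputable def blockSpace (A B : Matrix ι ι ℂ) :
    Submodule ℂ (Matrix ((ι ⊕ ι) ⊕ (ι ⊕ ι)) ((ι ⊕ ι) ⊕ (ι ⊕ ι)) ℂ) :=
  LinearMap.range (blockMap A B ∘ₗ (nomura₁ A).subtype.prodMap
    ((nomura₁ A).subtype.prodMap (nomura₁ A).subtype))

theorem mem_blockSpace {A B : Matrix ι ι ℂ}
    {M : Matrix ((ι ⊕ ι) ⊕ (ι ⊕ ι)) ((ι ⊕ ι) ⊕ (ι ⊕ ι)) ℂ} :
    M ∈ blockSpace A B ↔ ∃ R ∈ nomura₁ A, ∃ Q ∈ nomura₁ A, ∃ X ∈ nomura₁ A,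
      blockMap A B (R, Q, X) = M := by
  constructor
  · rintro ⟨⟨R, Q, X⟩, rfl⟩
    exact ⟨R, R.2, Q, Q.2, X, X.2, rfl⟩
  · rintro ⟨R, hR, Q, hQ, X, hX, rfl⟩
    exact ⟨(⟨R, hR⟩, ⟨Q, hQ⟩, ⟨X, hX⟩), rfl⟩

namespace IsInvertibleJonesPair

variable {A B R Q X R' Q' X' Z : Matrix ι ι ℂ}

theorem blockMap_injective (h : IsInvertibleJonesPair A B) :
    Function.Injective (blockMap A B) := by
  rintro ⟨R, Q, X⟩ ⟨R', Q', X'⟩ he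
  obtain ⟨h1, h2, h3⟩ := doubledBlocks_inj he
  exact Prod.ext h1 (Prod.ext (h.isUnit_right.mul_left_injective h3) (h.hadamard_injective h2))

theorem finrank_blockSpace (h : IsInvertibleJonesPair A B) :
    Module.finrank ℂ (blockSpace A B) = 3 * Module.finrank ℂ (nomura₁ A) := by
  rw [blockSpace, LinearMap.finrank_range_of_inj]
  · simp only [Module.finrank_prod]
    ring
  · rw [LinearMap.coe_comp]
    exact h.blockMap_injective.comp (Function.Injective.prodMap Subtype.val_injective
      (Function.Injective.prodMap Subtype.val_injective Subtype.val_injective))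

variable [Nonempty ι]

theorem conj_mul_transpose (h : IsInvertibleJonesPair A B) (hA : A.IsSymm)
    (hR : R ∈ nomura₁ A) : conj B R * B.transpose = B.transpose * R := by
  rw [h.conj_eq hA hR, Matrix.nonsing_inv_mul_cancel_right _ _
    ((Matrix.isUnit_iff_isUnit_det _).1 h.isUnit_transpose_right)]

theorem conj_mul_mul_transpose_mul (h : IsInvertibleJonesPair A B) (hA : A.IsSymm)
    (hQ : Q ∈ nomura₁ A) :
    conj B (Q * (B * B.transpose) * Q') = B.transpose * Q * (Q' * B) := by
  rw [conj_eq_iff h.isUnit_right, h.mul_comm_of_mem hQ (h.mul_transpose_mem hA)]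
  simp only [Matrix.mul_assoc]

/-- R slides past B and Bᵀ at the cost of conjugation, so the off-diagonal blocks keep their form,
and the lower right block is the conjugate of the upper left one. -/
theorem blockMap_mul (h : IsInvertibleJonesPair A B) (hA : A.IsSymm)
    (hR : R ∈ nomura₁ A) (hQ : Q ∈ nomura₁ A)
    (hZ : Matrix.hadamard A X * Matrix.hadamard A X' = Matrix.hadamard A Z)
    (hZ' : Matrix.hadamard A (conj B X) * Matrix.hadamard A (conj B X') =
      Matrix.hadamard A (conj B Z)) :
    blockMap A B (R, Q, X) * blockMap A B (R', Q', X') =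
      blockMap A B ((2 : ℂ) • (R * R' + Q * (B * B.transpose) * Q'),
        (2 : ℂ) • (R * Q' + Q * R'), (2 : ℂ) • Z) := by
  simp only [blockMap_apply, doubledBlocks_mul, map_smul, map_add, Matrix.hadamard_smul, hZ, hZ',
    h.conj_mul_mul_transpose_mul hA hQ, conj_mul h.isUnit_right, Matrix.smul_mul, Matrix.mul_smul,
    Matrix.add_mul, Matrix.mul_add]
  have h1 : Q * B * conj B R' = Q * R' * B := by
    rw [Matrix.mul_assoc, mul_conj h.isUnit_right, Matrix.mul_assoc]
  have h2 : conj B R * (B.transpose * Q') = B.transpose * (R * Q') := by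
    rw [← Matrix.mul_assoc, h.conj_mul_transpose hA hR, Matrix.mul_assoc]
  rw [h1, h2, Matrix.mul_assoc B.transpose Q R', add_comm (B.transpose * (Q * R')),
    add_comm (B.transpose * Q * (Q' * B))]
  simp only [Matrix.mul_assoc]

theorem isBoseMesner_blockSpace (h : IsInvertibleJonesPair A B) (hA : A.IsSymm) :
    IsBoseMesner (blockSpace A B) where
  one_mem := by
    obtain ⟨Z, hZ, hZ1, hZ2⟩ := h.exists_hadamard_eq_one hA
    refine mem_blockSpace.2 ⟨(2 : ℂ)⁻¹ • 1, Submodule.smul_mem _ _ hasTheta_one.mem, 0,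
      Submodule.zero_mem _, (2 : ℂ)⁻¹ • Z, Submodule.smul_mem _ _ hZ, ?_⟩
    rw [blockMap_apply, ← doubledBlocks_one]
    simp only [map_smul, Matrix.hadamard_smul, hZ1, hZ2, conj_one h.isUnit_right,
      Matrix.zero_mul, Matrix.mul_zero]
  allOnes_mem := by
    obtain ⟨Z, hZ, hZ1, hZ2⟩ := h.exists_mul_eq_allOnes hA
    refine mem_blockSpace.2 ⟨allOnes ι, h.allOnes_mem hA, Z, hZ, 0, Submodule.zero_mem _, ?_⟩
    -- J is Θ_A(I), and conjugation fixes I and commutes with Θ_A.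
    have h1 : conj B (allOnes ι) = allOnes ι :=
      HasTheta.unique h.schurInvertible_left
        (conj_one h.isUnit_right ▸ h.hasTheta_conj hA (hasTheta_one (A := A))) hasTheta_one
    rw [blockMap_apply, ← doubledBlocks_allOnes, hZ1, hZ2, h1, map_zero, Matrix.hadamard_zero]
  mul_mem := by
    intro M hM N hN
    obtain ⟨R, hR, Q, hQ, X, hX, rfl⟩ := mem_blockSpace.1 hM
    obtain ⟨R', hR', Q', hQ', X', hX', rfl⟩ := mem_blockSpace.1 hN
    obtain ⟨Z, hZ, hZ1, hZ2⟩ := h.exists_hadamard_mul hA hX hX'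
    rw [h.blockMap_mul hA hR hQ hZ1 hZ2]
    exact mem_blockSpace.2 ⟨_, Submodule.smul_mem _ _ (Submodule.add_mem _ (mul_mem_nomura₁ hR hR')
      (mul_mem_nomura₁ (mul_mem_nomura₁ hQ (h.mul_transpose_mem hA)) hQ')), _,
      Submodule.smul_mem _ _
        (Submodule.add_mem _ (mul_mem_nomura₁ hR hQ') (mul_mem_nomura₁ hQ hR')), _,
      Submodule.smul_mem _ _ hZ, rfl⟩
  mul_comm := by
    intro M hM N hN
    obtain ⟨R, hR, Q, hQ, X, hX, rfl⟩ := mem_blockSpace.1 hM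
    obtain ⟨R', hR', Q', hQ', X', hX', rfl⟩ := mem_blockSpace.1 hN
    obtain ⟨Z, hZ, hZ1, hZ2⟩ := h.exists_hadamard_mul hA hX hX'
    rw [h.blockMap_mul hA hR hQ hZ1 hZ2]
    rw [h.hadamard_mul_comm hA hX hX'] at hZ1
    rw [h.hadamard_mul_comm hA (h.conj_mem hA hX) (h.conj_mem hA hX')] at hZ2
    rw [h.blockMap_mul hA hR' hQ' hZ1 hZ2, h.mul_comm_of_mem hR hR',
      h.mul_comm_of_mem hR hQ', h.mul_comm_of_mem hQ hR', add_comm (Q' * R),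
      h.mul_comm_of_mem (mul_mem_nomura₁ hQ (h.mul_transpose_mem hA)) hQ', ← Matrix.mul_assoc,
      Matrix.mul_assoc Q', h.mul_comm_of_mem hQ (h.mul_transpose_mem hA)]
    simp only [Matrix.mul_assoc]
  transpose_mem := by
    intro M hM
    obtain ⟨R, hR, Q, hQ, X, hX, rfl⟩ := mem_blockSpace.1 hM
    refine mem_blockSpace.2 ⟨_, h.transpose_mem hR, _, h.transpose_mem hQ, _, h.transpose_mem hX,
      ?_⟩
    simp only [blockMap_apply, doubledBlocks_transpose, h.conj_transpose hA hR,
      h.conj_transpose hA hX, hadamard_transpose hA, Matrix.transpose_mul,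
      Matrix.transpose_transpose]
  hadamard_mem := by
    intro M hM N hN
    obtain ⟨R, hR, Q, hQ, X, hX, rfl⟩ := mem_blockSpace.1 hM
    obtain ⟨R', hR', Q', hQ', X', hX', rfl⟩ := mem_blockSpace.1 hN
    obtain ⟨Z, hZ, hZ1, hZ2⟩ := h.exists_mul_hadamard hA hQ hQ'
    have hXX := h.hadamard_mem hA hX hX'
    have hAA := h.hadamard_self_mem hA
    have hRX := h.hadamard_mem hA hR hX'
    have hXR := h.hadamard_mem hA hX hR'
    have hRR := h.hadamard_mem hA hR hR'
    -- Two alternating parts multiply to (A∘A)∘(X∘X'), which joins the constant part; the mixed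
    -- terms keep one factor A.
    refine mem_blockSpace.2 ⟨Matrix.hadamard R R' +
      Matrix.hadamard (Matrix.hadamard A A) (Matrix.hadamard X X'),
      Submodule.add_mem _ hRR (h.hadamard_mem hA hAA hXX), Z, hZ,
      Matrix.hadamard R X' + Matrix.hadamard X R', Submodule.add_mem _ hRX hXR, ?_⟩
    simp only [blockMap_apply, doubledBlocks_hadamard, hZ1, hZ2, map_add,
      h.conj_hadamard hA hR hR', h.conj_hadamard hA hAA hXX, h.conj_hadamard hA hX hX',
      h.conj_hadamard hA hR hX', h.conj_hadamard hA hX hR', h.conj_hadamard_self hA]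
    congr 1 <;> (ext i j; simp only [Matrix.add_apply, Matrix.hadamard_apply]; ring)

theorem blockMatrix_eq (h : IsInvertibleJonesPair A B) (hA : A.IsSymm) {F G : Matrix ι ι ℂ}
    (hF : HasTheta A F R) (hG : HasTheta A G Q) :
    blockMatrix A B F (Matrix.hadamard A G) (Matrix.hadamard A X)
        (Matrix.hadamard A (conj B X)) =
      blockMap A B (R, (Fintype.card ι : ℂ)⁻¹ • Q, X) := by
  have hA' := h.schurInvertible_left
  have hB := h.schurInvertible_right.schurInv
  rw [blockMatrix, hF.theta₁_eq hA', (h.hasTheta_schurInv_right hA hF).theta₁_eq hB,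
    h.theta_hadamard hA hG, h.theta_hadamard_transpose hA hG, Matrix.transpose_smul,
    Matrix.transpose_mul, Matrix.transpose_transpose, blockMap_apply, Matrix.smul_mul,
    Matrix.mul_smul]
  rfl

theorem coe_blockSpace (h : IsInvertibleJonesPair A B) (hA : A.IsSymm) :
    (blockSpace A B : Set _) = blockSet A B := by
  have hn : (Fintype.card ι : ℂ) ≠ 0 := card_ne_zero
  ext M
  rw [SetLike.mem_coe, mem_blockSpace]
  constructor
  · rintro ⟨R, hR, Q, hQ, X, hX, rfl⟩
    obtain ⟨F, hF⟩ := h.exists_theta_eq hA hR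
    -- The factor n offsets the n⁻¹ in Θ_{A,B}(A ∘ G).
    obtain ⟨G, hG⟩ := h.exists_theta_eq hA
      (Submodule.smul_mem _ (Fintype.card ι : ℂ) hQ)
    refine ⟨F, hF.mem, _, h.hadamard_mem_nomura hA hG.mem, _, h.hadamard_mem_nomura hA hX, _,
      h.isPaired_hadamard hA hX, ?_⟩
    rw [h.blockMatrix_eq hA hF hG, smul_smul, inv_mul_cancel₀ hn, one_smul]
  · rintro ⟨F, hF, G, hG, H, hH, K, hK, rfl⟩
    obtain ⟨R, hR⟩ := exists_hasTheta hF
    obtain ⟨Y, hY, rfl⟩ := h.exists_hadamard_eq hA hG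
    obtain ⟨X, hX, rfl⟩ := h.exists_hadamard_eq hA hH
    obtain ⟨Q, hQ⟩ := exists_hasTheta hY
    rw [h.isPaired_unique hK (h.isPaired_hadamard hA hX)]
    exact ⟨R, h.mem_of_hasTheta hA hR, _, Submodule.smul_mem _ _ (h.mem_of_hasTheta hA hQ), X, hX,
      (h.blockMatrix_eq hA hR hQ).symm⟩

end IsInvertibleJonesPair

end JonesPair

theorem mainTheorem2 (n : ℕ) (A B : Matrix (Fin n) (Fin n) ℂ)
    (hAB : JonesPair.IsInvertibleJonesPair A B) (hA : A.IsSymm) :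
    -- the matrices `M(F, G, H)` are well defined
    (∀ F ∈ JonesPair.nomura₁ A, F ∈ JonesPair.nomura₁ (JonesPair.schurInv B)) ∧
    (∀ G ∈ JonesPair.nomura A B, G.transpose ∈ JonesPair.nomura A B) ∧
    (∀ H ∈ JonesPair.nomura A B, ∃! K, JonesPair.IsPaired A B H K) ∧
    -- they form a Bose-Mesner algebra of dimension `3 * dim N_A`
    ∃ 𝔅 : Submodule ℂ (Matrix ((Fin n ⊕ Fin n) ⊕ (Fin n ⊕ Fin n))
        ((Fin n ⊕ Fin n) ⊕ (Fin n ⊕ Fin n)) ℂ),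
      (𝔅 : Set (Matrix ((Fin n ⊕ Fin n) ⊕ (Fin n ⊕ Fin n))
        ((Fin n ⊕ Fin n) ⊕ (Fin n ⊕ Fin n)) ℂ)) = JonesPair.blockSet A B ∧
      JonesPair.IsBoseMesner 𝔅 ∧
      Module.finrank ℂ 𝔅 = 3 * Module.finrank ℂ (JonesPair.nomura₁ A) := by
  -- The general argument divides by n; for n = 0 all matrices coincide.
  rcases Nat.eq_zero_or_pos n with rfl | hn
  · have h0 : ∀ {C D : Matrix (Fin 0) (Fin 0) ℂ}, C = D := fun {C D} => Subsingleton.elim C D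
    have hmem : ∀ (N : Submodule ℂ (Matrix (Fin 0) (Fin 0) ℂ)) C, C ∈ N := fun N C => by
      rw [h0 (C := C) (D := 0)]; exact N.zero_mem
    refine ⟨fun _ _ => hmem _ _, fun _ _ => hmem _ _,
      fun H _ => ⟨0, ⟨hmem _ _, h0⟩, fun _ _ => h0⟩, ⊤, ?_, ?_, ?_⟩
    · refine (Set.eq_univ_of_forall fun M => ?_).symm
      exact ⟨0, hmem _ _, 0, hmem _ _, 0, hmem _ _, 0, ⟨hmem _ _, h0⟩, Subsingleton.elim _ _⟩
    · exact ⟨trivial, trivial, fun _ _ _ _ => trivial, fun _ _ _ _ => Subsingleton.elim _ _,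
        fun _ _ => trivial, fun _ _ _ _ => trivial⟩
    · rw [Module.finrank_zero_of_subsingleton, Module.finrank_zero_of_subsingleton]
  · have : Nonempty (Fin n) := ⟨⟨0, hn⟩⟩
    refine ⟨fun F hF => ?_, fun G hG => hAB.transpose_mem_nomura hA hG, fun H hH => ?_,
      JonesPair.blockSpace A B, hAB.coe_blockSpace hA, hAB.isBoseMesner_blockSpace hA,
      hAB.finrank_blockSpace⟩
    · obtain ⟨S, hS⟩ := JonesPair.exists_hasTheta hF
      exact (hAB.hasTheta_schurInv_right hA hS).mem
    · obtain ⟨X, hX, rfl⟩ := hAB.exists_hadamard_eq hA hH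
      exact ⟨_, hAB.isPaired_hadamard hA hX,
        fun K hK => hAB.isPaired_unique hK (hAB.isPaired_hadamard hA hX)⟩
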